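/- A CAT(1) space is a metric space $X$ in which any two points at distance $<\pi$ are joined by a geodesic and in which, for every geodesic triangle of perimeter $<2\pi$, the distance between any two points of the triangle is at most the distance between the corresponding points of the model triangle with the same side lengths in the unit sphere $S^2$ (with its great-circle metric). A discrete-time simple pursuit of step size $D>0$ in $X$ consists of sequences $P_0,P_1,\dots$ (pursuer) and $E_0,E_1,\dots$ (evader) in $X$ such that $d(E_i,E_{i+1})\le D$ for all $i$ and, as long as $d(P_i,E_i)>D$, the point $P_{i+1}$ is the point at distance $D$ from $P_i$ on a geodesic from $P_i$ to $E_i$. The evader wins if $d(P_i,E_i)>D$ for all $i$ and $\lim_{i\to\infty} d(P_i,E_i)>D$. The pursuit curve is the curve $\gamma:[0,\infty)\to X$ with $\gamma(iD)=P_i$ that joins successive points $P_i,P_{i+1}$ by unit-speed geodesic segments. **Proposition.** Let $X$ be a compact CAT(1) space, and suppose that the evader wins a discrete-time simple pursuit in $X$ with initial distance $d(P_0,E_0)<\pi$. Then there is a bilaterally infinite local geodesic $\rho:\mathbb R\to X$ (every $t\in\mathbb R$ has a neighbourhood on which $d(\rho(s),\rho(s'))=|s-s'|$) such that every finite segment of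 $\rho$ is a limit of segments of the pursuit curve $\gamma$: for all $a\le b$ there are $u_n\ge 0$ such that $\gamma(u_n+(s-a))\to\rho(s)$ as $n\to\infty$, uniformly for $s\in[a,b]$. -/

import Mathlib

namespace Pursuit

/-- `σ`, restricted to `[0, dist x y]`, is a geodesic (parametrized by arclength) from `x` to `y`. -/
def IsGeodesicFromTo {X : Type*} [MetricSpace X] (σ : ℝ → X) (x y : X) : Prop :=
  σ 0 = x ∧ σ (dist x y) = y ∧
    ∀ s ∈ Set.Icc 0 (dist x y), ∀ t ∈ Set.Icc 0 (dist x y), dist (σ s) (σ t) = |s - t|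

/-- `ρ : ℝ → X` is a bilaterally infinite local geodesic: every parameter value has a neighbourhood
on which `ρ` is a geodesic. -/
def IsLocalGeodesicLine {X : Type*} [MetricSpace X] (ρ : ℝ → X) : Prop :=
  ∀ t : ℝ, ∃ ε > 0, ∀ s ∈ Set.Ioo (t - ε) (t + ε), ∀ s' ∈ Set.Ioo (t - ε) (t + ε),
    dist (ρ s) (ρ s') = |s - s'|

/-- The unit sphere in Euclidean 3-space. -/
abbrev ModelSphere : Type := Metric.sphere (0 : EuclideanSpace ℝ (Fin 3)) 1

/-- The intrinsic (great-circle) distance of the unit sphere. -/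
noncomputable def sphDist (u v : ModelSphere) : ℝ :=
  InnerProductGeometry.angle (u : EuclideanSpace ℝ (Fin 3)) (v : EuclideanSpace ℝ (Fin 3))

/-- `X` is a CAT(1) space: points at distance `< π` are joined by a geodesic, and geodesic
triangles of perimeter `< 2π` are no fatter than their model triangles in the unit sphere.

In `comparison` the triangle has vertices `p q r` and sides `σ` (from `p` to `q`), `τ` (from `p`
to `r`) and `υ` (from `q` to `r`); the two compared points are `σ s` and `τ t`. The points `p' q' r'`
form a model triangle, and `x'`, `y'` are the points of its sides `p'q'`, `p'r'` that correspond
to `σ s`, `τ t` (they are determined by their distances to the end points, because all sides are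
shorter than `π`). As `p, q, r` are arbitrary, any two points on different sides are covered;
for two points of one side the comparison is an equality that always holds. -/
structure IsCATOne (X : Type*) [MetricSpace X] : Prop where
  exists_geodesic : ∀ x y : X, dist x y < Real.pi → ∃ σ : ℝ → X, IsGeodesicFromTo σ x y
  comparison : ∀ (p q r : X) (σ τ υ : ℝ → X),
    IsGeodesicFromTo σ p q → IsGeodesicFromTo τ p r → IsGeodesicFromTo υ q r →
    dist p q + dist q r + dist r p < 2 * Real.pi →
    ∀ p' q' r' : ModelSphere,
      sphDist p' q' = dist p q → sphDist q' r' = dist q r → sphDist r' p' = dist r p →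
      ∀ s ∈ Set.Icc 0 (dist p q), ∀ t ∈ Set.Icc 0 (dist p r), ∀ x' y' : ModelSphere,
        sphDist p' x' = s → sphDist x' q' = dist p q - s →
        sphDist p' y' = t → sphDist y' r' = dist p r - t →
        dist (σ s) (τ t) ≤ sphDist x' y'

/-- `P` and `E` are the pursuer's and the evader's positions in a discrete-time simple pursuit of
step size `D > 0`: at each step the evader moves by at most `D`, and, as long as the evader has not
been caught, the pursuer moves by exactly `D` along a geodesic towards the evader's position. -/
structure IsSimplePursuit {X : Type*} [MetricSpace X] (D : ℝ) (P E : ℕ → X) : Prop where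
  step_pos : 0 < D
  evader_move : ∀ i, dist (E i) (E (i + 1)) ≤ D
  pursuer_move : ∀ i, D < dist (P i) (E i) →
    ∃ σ : ℝ → X, IsGeodesicFromTo σ (P i) (E i) ∧ σ D = P (i + 1)

/-- The evader wins: the separation always exceeds the step size `D` (the pursuer never gets within
distance `D`), and its limit exceeds `D` too. -/
def EvaderWins {X : Type*} [MetricSpace X] (D : ℝ) (P E : ℕ → X) : Prop :=
  (∀ i, D < dist (P i) (E i)) ∧
    ∃ L : ℝ, D < L ∧ Filter.Tendsto (fun i => dist (P i) (E i)) Filter.atTop (nhds L)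

/-- `γ`, restricted to `[0, ∞)`, is the pursuit curve: it joins the consecutive positions
`P i = γ (i * D)` by unit-speed geodesic segments. -/
def IsPursuitCurve {X : Type*} [MetricSpace X] (D : ℝ) (P : ℕ → X) (γ : ℝ → X) : Prop :=
  ∀ i : ℕ, γ (i * D) = P i ∧
    ∀ s ∈ Set.Icc (i * D) ((i + 1) * D), ∀ t ∈ Set.Icc (i * D) ((i + 1) * D),
      dist (γ s) (γ t) = |s - t|

/-- The segment `ρ|[a, b]` is the limit of segments of the curve `γ : [0, ∞) → X`: there are
segments `γ|[u n, u n + (b - a)]` which, with the parameter shifted to `[a, b]`, converge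
uniformly to `ρ|[a, b]`. -/
def IsLimitOfSegments {X : Type*} [MetricSpace X] (γ ρ : ℝ → X) (a b : ℝ) : Prop :=
  ∃ u : ℕ → ℝ, (∀ n, 0 ≤ u n) ∧
    TendstoUniformlyOn (fun n s => γ (u n + (s - a))) ρ Filter.atTop (Set.Icc a b)

end Pursuit

namespace Pursuit

open Filter Real

/-! Write l_i for the separation. It never increases and tends to some L > D. The triangle on
P_{i+1}, E_i, E_{i+1} has sides l_i - D, d(E_i, E_{i+1}) and l_{i+1}, which tend to L - D, D and L.
It degenerates, so its model angle at P_{i+1} tends to 0, and by CAT(1) comparison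
(`IsCATOne.dist_le_arccos`) the next pursuit segment nearly prolongs the last one (`exists_defect`).
Hence γ, which is 1-Lipschitz, is asymptotically geodesic on windows of a fixed length δ. By
compactness the shifts γ(n + ·) have a limit, defined on all of ℝ and geodesic on every window of
length δ (`exists_limit_localGeodesicLine`). -/

/-! ### Comparison triangles in the sphere -/

/-- The point of the unit sphere at distance `a` from the pole, in the direction `θ`. -/
noncomputable def polar (a θ : ℝ) : ModelSphere :=
  ⟨!₂[cos a, sin a * cos θ, sin a * sin θ], by
    rw [mem_sphere_zero_iff_norm, EuclideanSpace.norm_eq, Real.sqrt_eq_one]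
    simp only [Fin.sum_univ_three, Real.norm_eq_abs, sq_abs]
    simp only [Matrix.cons_val_zero, Matrix.cons_val_one, Matrix.cons_val]
    linear_combination sin a ^ 2 * sin_sq_add_cos_sq θ + sin_sq_add_cos_sq a⟩

theorem sphDist_polar (a b θ φ : ℝ) :
    sphDist (polar a θ) (polar b φ) = arccos (cos a * cos b + sin a * sin b * cos (θ - φ)) := by
  have h (v : ModelSphere) : ‖(v : EuclideanSpace ℝ (Fin 3))‖ = 1 :=
    mem_sphere_zero_iff_norm.1 v.2
  rw [sphDist, InnerProductGeometry.angle, h, h, PiLp.inner_apply]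
  congr 1
  simp only [polar, Fin.sum_univ_three, PiLp.toLp_apply, Matrix.cons_val_zero, Matrix.cons_val_one,
    Matrix.cons_val, RCLike.inner_apply, conj_trivial, cos_sub]
  ring

theorem sphDist_polar_meridian {a b : ℝ} (θ : ℝ) (hab : a ≤ b) (hb : b - a ≤ π) :
    sphDist (polar a θ) (polar b θ) = b - a := by
  rw [sphDist_polar, sub_self, cos_zero, mul_one, ← cos_sub, ← cos_neg, neg_sub,
    arccos_cos (by linarith) hb]

theorem sphDist_polar_pole {a : ℝ} (φ θ : ℝ) (ha : 0 ≤ a) (ha' : a ≤ π) :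
    sphDist (polar 0 φ) (polar a θ) = a := by
  rw [sphDist_polar, sin_zero, cos_zero, zero_mul, zero_mul, one_mul, add_zero, arccos_cos ha ha']

theorem sphDist_comm (u v : ModelSphere) : sphDist u v = sphDist v u :=
  InnerProductGeometry.angle_comm _ _

/-- In a CAT(1) space, the points at distance `δ` from the common end on two sides of a triangle
are no farther apart than the spherical law of cosines predicts. -/
theorem IsCATOne.dist_le_arccos {X : Type*} [MetricSpace X] (hX : IsCATOne X) {p q r : X}
    {σ τ υ : ℝ → X} (hσ : IsGeodesicFromTo σ p q) (hτ : IsGeodesicFromTo τ p r)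
    (hυ : IsGeodesicFromTo υ q r) (hper : dist p q + dist q r + dist r p < 2 * π)
    (hpq : p ≠ q) (hpr : p ≠ r) {δ : ℝ} (hδ : 0 ≤ δ) (hδq : δ ≤ dist p q) (hδr : δ ≤ dist p r) :
    dist (σ δ) (τ δ) ≤ arccos (1 - sin δ ^ 2 *
      ((cos (dist p q - dist p r) - cos (dist q r)) / (sin (dist p q) * sin (dist p r)))) := by
  have hcmp := hX.comparison p q r σ τ υ hσ hτ hυ hper
  have ha : 0 < dist p q := dist_pos.2 hpq
  have hc : 0 < dist p r := dist_pos.2 hpr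
  have t1 := dist_triangle p q r
  have t2 := dist_triangle q p r
  have t3 := dist_triangle p r q
  rw [dist_comm q p] at t2
  rw [dist_comm r q] at t3
  rw [dist_comm r p] at hcmp hper
  set a := dist p q
  set b := dist q r
  set c := dist p r
  have hb : 0 ≤ b := dist_nonneg
  have haπ : a < π := by linarith
  have hbπ : b < π := by linarith
  have hcπ : c < π := by linarith
  have hs : 0 < sin a * sin c :=
    mul_pos (sin_pos_of_pos_of_lt_pi ha haπ) (sin_pos_of_pos_of_lt_pi hc hcπ)
  have hcos : cos b ≤ cos (a - c) := by
    rw [← cos_abs (a - c)]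
    exact cos_le_cos_of_nonneg_of_le_pi (abs_nonneg _) hbπ.le
      (abs_le.2 ⟨by linarith, by linarith⟩)
  have hcos' : cos (a + c) ≤ cos b := by
    rcases le_total (a + c) π with h | h
    · exact cos_le_cos_of_nonneg_of_le_pi hb h t2
    · rw [← cos_two_pi_sub (a + c)]
      exact cos_le_cos_of_nonneg_of_le_pi hb (by linarith) (by linarith)
  rw [cos_sub] at hcos
  rw [cos_add] at hcos'
  -- The cosine of the model angle at `p`; `hcos` and `hcos'` place it in [-1, 1].
  set k := (cos b - cos a * cos c) / (sin a * sin c) with hk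
  have hk1 : cos (arccos k) = k :=
    cos_arccos ((le_div_iff₀ hs).2 (by linarith)) ((div_le_one hs).2 (by linarith))
  have hks : sin a * sin c * k = cos b - cos a * cos c := mul_div_cancel₀ _ hs.ne'
  have key := hcmp (polar 0 0) (polar a 0) (polar c (arccos k))
    (sphDist_polar_pole _ _ ha.le haπ.le)
    (by
      rw [sphDist_polar, zero_sub, cos_neg, hk1, hks, add_sub_cancel, arccos_cos hb hbπ.le])
    (by rw [sphDist_comm, sphDist_polar_pole _ _ hc.le hcπ.le])
    δ ⟨hδ, hδq⟩ δ ⟨hδ, hδr⟩ (polar δ 0) (polar δ (arccos k))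
    (sphDist_polar_pole _ _ hδ (by linarith))
    (sphDist_polar_meridian _ hδq (by linarith))
    (sphDist_polar_pole _ _ hδ (by linarith))
    (sphDist_polar_meridian _ hδr (by linarith))
  refine key.trans_eq ?_
  rw [sphDist_polar, zero_sub, cos_neg, hk1]
  congr 1
  have : (cos (a - c) - cos b) / (sin a * sin c) = 1 - k := by
    rw [hk, cos_sub, div_eq_iff hs.ne', sub_mul, div_mul_cancel₀ _ hs.ne']
    ring
  rw [this]
  linear_combination sin_sq_add_cos_sq δ

/-! ### Geodesics and the pursuit curve -/

/-- Replacing an initial segment of a geodesic by another geodesic gives a geodesic. -/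
theorem IsGeodesicFromTo.concat {X : Type*} [MetricSpace X] {σ α : ℝ → X} {x y : X} {D : ℝ}
    (hσ : IsGeodesicFromTo σ x y) (hD : 0 ≤ D) (hDy : D ≤ dist x y) (hα0 : α 0 = x)
    (hαD : α D = σ D)
    (hα : ∀ s ∈ Set.Icc 0 D, ∀ t ∈ Set.Icc 0 D, dist (α s) (α t) = |s - t|) :
    IsGeodesicFromTo (fun s => if s ≤ D then α s else σ s) x y := by
  obtain ⟨h0, h1, h⟩ := hσ
  have mixed : ∀ s t, 0 ≤ s → s ≤ D → D ≤ t → t ≤ dist x y → dist (α s) (σ t) = t - s := by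
    intro s t hs hsD hDt ht
    have d1 := hα s ⟨hs, hsD⟩ D ⟨hD, le_rfl⟩
    have d2 := h D ⟨hD, hDy⟩ t ⟨by linarith, ht⟩
    have d3 := hα 0 ⟨le_rfl, hD⟩ s ⟨hs, hsD⟩
    have d4 := h t ⟨by linarith, ht⟩ (dist x y) ⟨dist_nonneg, le_rfl⟩
    rw [abs_sub_comm, abs_of_nonneg (by linarith)] at d1 d2 d3 d4
    rw [hα0] at d3
    rw [h1] at d4
    rw [hαD] at d1
    have t1 := dist_triangle (α s) (σ D) (σ t)
    have t2 := dist_triangle4 x (α s) (σ t) y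
    linarith
  refine ⟨by simp only [hD, if_true, hα0], ?_, ?_⟩
  · rcases hDy.eq_or_lt with e | e
    · simp only [← e, le_refl, if_true, hαD]
      rw [e, h1]
    · simp only [not_le.2 e, if_false, h1]
  · rintro s ⟨hs, hs'⟩ t ⟨ht, ht'⟩
    by_cases hsD : s ≤ D <;> by_cases htD : t ≤ D <;> simp only [hsD, htD, if_true, if_false]
    · exact hα s ⟨hs, hsD⟩ t ⟨ht, htD⟩
    · rw [mixed s t hs hsD (by linarith) ht', abs_sub_comm, abs_of_nonneg (by linarith)]
    · rw [dist_comm, mixed t s ht htD (by linarith) hs', abs_of_nonneg (by linarith)]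
    · exact h s ⟨hs, hs'⟩ t ⟨ht, ht'⟩

theorem IsGeodesicFromTo.dist_left {X : Type*} [MetricSpace X] {σ : ℝ → X} {x y : X}
    (hσ : IsGeodesicFromTo σ x y) {s : ℝ} (hs : 0 ≤ s) (hs' : s ≤ dist x y) :
    dist x (σ s) = s := by
  have := hσ.2.2 0 ⟨le_rfl, dist_nonneg⟩ s ⟨hs, hs'⟩
  rwa [hσ.1, zero_sub, abs_neg, abs_of_nonneg hs] at this

theorem IsGeodesicFromTo.dist_right {X : Type*} [MetricSpace X] {σ : ℝ → X} {x y : X}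
    (hσ : IsGeodesicFromTo σ x y) {s : ℝ} (hs : 0 ≤ s) (hs' : s ≤ dist x y) :
    dist (σ s) y = dist x y - s := by
  have := hσ.2.2 s ⟨hs, hs'⟩ (dist x y) ⟨dist_nonneg, le_rfl⟩
  rwa [hσ.2.1, abs_sub_comm, abs_of_nonneg (by linarith)] at this

/-- The final segment of a geodesic is a geodesic. -/
theorem IsGeodesicFromTo.tail {X : Type*} [MetricSpace X] {σ : ℝ → X} {x y : X} {D : ℝ}
    (hσ : IsGeodesicFromTo σ x y) (hD : 0 ≤ D) (hDy : D ≤ dist x y) :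
    IsGeodesicFromTo (fun s => σ (D + s)) (σ D) y := by
  have hd := hσ.dist_right hD hDy
  refine ⟨by simp, ?_, ?_⟩
  · simp only [hd, add_sub_cancel, hσ.2.1]
  · rintro s ⟨hs, hs'⟩ t ⟨ht, ht'⟩
    rw [hd] at hs' ht'
    rw [hσ.2.2 (D + s) ⟨by linarith, by linarith⟩ (D + t) ⟨by linarith, by linarith⟩,
      add_sub_add_left_eq_sub]

theorem exists_nat_mem_Ico {D s : ℝ} (hD : 0 < D) (hs : 0 ≤ s) :
    ∃ k : ℕ, k * D ≤ s ∧ s < (k + 1) * D := by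
  refine ⟨⌊s / D⌋₊, ?_, ?_⟩
  · exact (le_div_iff₀ hD).1 (Nat.floor_le (div_nonneg hs hD.le))
  · exact (div_lt_iff₀ hD).1 (Nat.lt_floor_add_one _)

theorem IsPursuitCurve.dist_le {X : Type*} [MetricSpace X] {D : ℝ} {P : ℕ → X} {γ : ℝ → X}
    (hγ : IsPursuitCurve D P γ) (hD : 0 < D) {s t : ℝ} (hs : 0 ≤ s) (hst : s ≤ t) :
    dist (γ s) (γ t) ≤ t - s := by
  have main : ∀ n : ℕ, ∀ t, n * D ≤ t → t ≤ (n + 1) * D → s ≤ t → dist (γ s) (γ t) ≤ t - s := by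
    intro n
    induction n with
    | zero =>
      intro t ht ht' hst
      rw [(hγ 0).2 s ⟨by simpa using hs, by linarith⟩ t ⟨ht, ht'⟩, abs_sub_comm,
        abs_of_nonneg (by linarith)]
    | succ n ih =>
      intro t ht ht' hst
      by_cases h : ((n + 1 : ℕ) : ℝ) * D ≤ s
      · rw [(hγ (n + 1)).2 s ⟨h, by linarith⟩ t ⟨ht, ht'⟩, abs_sub_comm,
          abs_of_nonneg (by linarith)]
      · have h1 := ih (((n + 1 : ℕ) : ℝ) * D) (by push_cast; linarith) (by push_cast; linarith)
          (by linarith)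
        have h2 := (hγ (n + 1)).2 (((n + 1 : ℕ) : ℝ) * D) ⟨le_rfl, by linarith⟩ t ⟨ht, ht'⟩
        rw [abs_sub_comm, abs_of_nonneg (by linarith)] at h2
        linarith [dist_triangle (γ s) (γ (((n + 1 : ℕ) : ℝ) * D)) (γ t)]
  obtain ⟨n, hn, hn'⟩ := exists_nat_mem_Ico hD (hs.trans hst)
  exact main n t hn hn'.le hst

/-! ### Asymptotic straightness of the pursuit -/

section Pursuit

variable {X : Type*} [MetricSpace X] {D : ℝ} {P E : ℕ → X}

theorem IsSimplePursuit.dist_succ_evader (hPE : IsSimplePursuit D P E) {i : ℕ}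
    (hi : D < dist (P i) (E i)) : dist (P (i + 1)) (E i) = dist (P i) (E i) - D := by
  obtain ⟨σ, hσ, h⟩ := hPE.pursuer_move i hi
  rw [← h, hσ.dist_right hPE.step_pos.le hi.le]

theorem IsSimplePursuit.antitone_dist (hPE : IsSimplePursuit D P E)
    (hwin : ∀ i, D < dist (P i) (E i)) : Antitone fun i => dist (P i) (E i) := by
  refine antitone_nat_of_succ_le fun i => ?_
  linarith [hPE.dist_succ_evader (hwin i), hPE.evader_move i,
    dist_triangle (P (i + 1)) (E i) (E (i + 1))]

/-- When the evader wins, the pursuit curve has an asymptotically negligible defect of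
geodesicity across each vertex. -/
theorem IsSimplePursuit.exists_defect (hX : IsCATOne X) (hPE : IsSimplePursuit D P E)
    (hwin : ∀ i, D < dist (P i) (E i)) {L : ℝ} (hDL : D < L)
    (hL : Tendsto (fun i => dist (P i) (E i)) atTop (nhds L)) (h0 : dist (P 0) (E 0) < π)
    {γ : ℝ → X} (hγ : IsPursuitCurve D P γ) {δ : ℝ} (hδ : 0 < δ) (hδD : δ ≤ D)
    (hδL : δ ≤ L - D) :
    ∃ e : ℕ → ℝ, Tendsto e atTop (nhds 0) ∧
      ∀ i : ℕ, D + δ - e i ≤ dist (P i) (γ ((i + 1) * D + δ)) := by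
  have hD := hPE.step_pos
  have hanti := hPE.antitone_dist hwin
  have hge : ∀ i, L ≤ dist (P i) (E i) := fun i => hanti.le_of_tendsto hL i
  have hlt : ∀ i, dist (P i) (E i) < π := fun i => (hanti (Nat.zero_le i)).trans_lt h0
  have hL' : Tendsto (fun i => dist (P (i + 1)) (E (i + 1))) atTop (nhds L) :=
    hL.comp (tendsto_add_atTop_nat 1)
  have hLD : Tendsto (fun i => dist (P i) (E i) - D) atTop (nhds (L - D)) := hL.sub_const D
  -- Squeezed between l_{i+1} - (l_i - D) and D.
  have hb : Tendsto (fun i => dist (E i) (E (i + 1))) atTop (nhds D) := by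
    refine tendsto_of_tendsto_of_tendsto_of_le_of_le (g := fun i => dist (P (i + 1)) (E (i + 1)) -
      (dist (P i) (E i) - D)) ?_ tendsto_const_nhds (fun i => ?_) hPE.evader_move
    · simpa using hL'.sub hLD
    · have := dist_triangle (P (i + 1)) (E i) (E (i + 1))
      have := hPE.dist_succ_evader (hwin i)
      simp only
      linarith
  refine ⟨fun i => arccos (1 - sin δ ^ 2 *
    ((cos (dist (P i) (E i) - D - dist (P (i + 1)) (E (i + 1))) - cos (dist (E i) (E (i + 1)))) /
      (sin (dist (P i) (E i) - D) * sin (dist (P (i + 1)) (E (i + 1)))))), ?_, fun i => ?_⟩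
  · have hπ : L < π := (hge 0).trans_lt h0
    -- Here L > D is essential: the limit triangle keeps a nonzero side L - D.
    have hs : sin (L - D) * sin L ≠ 0 :=
      (mul_pos (sin_pos_of_pos_of_lt_pi (by linarith) (by linarith))
        (sin_pos_of_pos_of_lt_pi (by linarith) hπ)).ne'
    have hnum := ((continuous_cos.tendsto _).comp (hLD.sub hL')).sub
      ((continuous_cos.tendsto _).comp hb)
    have hden := ((continuous_sin.tendsto _).comp hLD).mul ((continuous_sin.tendsto _).comp hL')
    have := (continuous_arccos.tendsto _).comp
      (((hnum.div hden hs).const_mul (sin δ ^ 2)).const_sub 1)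
    have hz : L - D - L = -D := by ring
    rw [hz, cos_neg, sub_self, zero_div, mul_zero, sub_zero, arccos_one] at this
    exact this
  · obtain ⟨σ, hσ, hσD⟩ := hPE.pursuer_move i (hwin i)
    obtain ⟨τ, hτ, hτD⟩ := hPE.pursuer_move (i + 1) (hwin (i + 1))
    have hd := hPE.dist_succ_evader (hwin i)
    have hb' := hPE.evader_move i
    have hgi := hge i
    have hgi' := hge (i + 1)
    have hli := hlt i
    have hli' := hlt (i + 1)
    have hσ' := hσ.tail hD.le (hwin i).le
    rw [hσD] at hσ'
    have hγi := hγ (i + 1)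
    have hγi' := (hγ (i + 2)).1
    push_cast at hγi hγi'
    -- The geodesic behind the pursuer's move need not follow γ, so its first segment is replaced by
    -- that of γ.
    have hτ' := hτ.concat (α := fun s => γ ((i + 1) * D + s)) hD.le (hwin (i + 1)).le
      (by simpa using hγi.1)
      (by
        rw [hτD, ← hγi']
        congr 1
        ring)
      (by
        rintro s ⟨hs, hs'⟩ t ⟨ht, ht'⟩
        rw [hγi.2 _ ⟨by linarith, by linarith⟩ _ ⟨by linarith, by linarith⟩,
          add_sub_add_left_eq_sub])
    obtain ⟨υ, hυ⟩ := hX.exists_geodesic (E i) (E (i + 1)) (by linarith)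
    have key := hX.dist_le_arccos hσ' hτ' hυ
      (by rw [dist_comm (E (i + 1))]; linarith)
      (dist_pos.1 (by linarith)) (dist_pos.1 (by linarith)) hδ.le (by linarith) (by linarith)
    simp only [hδD, if_true, hd] at key
    have h1 := hσ.dist_left (s := D + δ) (by linarith) (by linarith)
    have h2 := dist_triangle (P i) (γ ((i + 1) * D + δ)) (σ (D + δ))
    rw [dist_comm (γ _)] at h2
    linarith

/-- When the evader wins, the pursuit curve is asymptotically a geodesic on intervals of some
fixed length. -/
theorem IsSimplePursuit.exists_asymptotically_geodesic (hX : IsCATOne X)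
    (hPE : IsSimplePursuit D P E) (hwin : EvaderWins D P E) (h0 : dist (P 0) (E 0) < π)
    {γ : ℝ → X} (hγ : IsPursuitCurve D P γ) :
    ∃ δ > 0, ∀ ε > 0, ∃ T : ℝ, ∀ s t, T ≤ s → s ≤ t → t ≤ s + δ →
      t - s - ε ≤ dist (γ s) (γ t) := by
  obtain ⟨hw, L, hDL, hL⟩ := hwin
  have hD := hPE.step_pos
  -- A window of length at most D crosses at most one vertex; L - D bounds the side from P_{i+1} to
  -- E_i from below.
  have hδ : 0 < min D (L - D) := lt_min hD (by linarith)
  obtain ⟨e, he, hbound⟩ := hPE.exists_defect hX hw hDL hL h0 hγ hδ (min_le_left _ _)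
    (min_le_right _ _)
  have hδD : min D (L - D) ≤ D := min_le_left _ _
  set δ := min D (L - D)
  refine ⟨δ, hδ, fun ε hε => ?_⟩
  obtain ⟨N, hN⟩ := eventually_atTop.1 (he.eventually (gt_mem_nhds hε))
  refine ⟨N * D, fun s t hs hst ht => ?_⟩
  have hs0 : 0 ≤ s := le_trans (by positivity) hs
  obtain ⟨k, hk, hk'⟩ := exists_nat_mem_Ico hD hs0
  by_cases htk : t ≤ (k + 1) * D
  · rw [(hγ k).2 s ⟨hk, hk'.le⟩ t ⟨by linarith, htk⟩, abs_sub_comm, abs_of_nonneg (by linarith)]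
    linarith
  · have hNk : N ≤ k := by
      have : (N : ℝ) < k + 1 := lt_of_mul_lt_mul_right (hs.trans_lt hk') hD.le
      exact_mod_cast Nat.lt_succ_iff.1 (by exact_mod_cast this)
    have h1 := hbound k
    have h2 := hN k hNk
    have h3 := hγ.dist_le hD (by positivity) hk
    have h4 := hγ.dist_le hD (by linarith) (show t ≤ (k + 1) * D + δ by linarith)
    rw [(hγ k).1] at h3
    -- The defect between the outer points bounds the one between `s` and `t`, as γ is 1-Lipschitz.
    linarith [dist_triangle4 (P k) (γ s) (γ t) (γ ((k + 1) * D + δ))]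

end Pursuit

/-! ### Passing to the limit -/

/-- A ray in a compact space that is asymptotically a geodesic on intervals of a fixed length
subconverges to a bilaterally infinite local geodesic. -/
theorem exists_limit_localGeodesicLine {X : Type*} [MetricSpace X] [CompactSpace X] {γ : ℝ → X}
    (hlip : ∀ s t, 0 ≤ s → s ≤ t → dist (γ s) (γ t) ≤ t - s) {δ : ℝ} (hδ : 0 < δ)
    (hγ : ∀ ε > 0, ∃ T : ℝ, ∀ s t, T ≤ s → s ≤ t → t ≤ s + δ → t - s - ε ≤ dist (γ s) (γ t)) :
    ∃ ρ : ℝ → X, IsLocalGeodesicLine ρ ∧ ∀ a b : ℝ, a ≤ b → IsLimitOfSegments γ ρ a b := by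
  -- An ultrafilter gives limits at all `t` at once, without a diagonal argument.
  have hU : (hyperfilter ℕ : Filter ℕ) ≤ atTop := Nat.hyperfilter_le_atTop
  have hex (t : ℝ) : ∃ x, Tendsto (fun n : ℕ => γ (n + t)) (hyperfilter ℕ) (nhds x) :=
    ⟨_, ((hyperfilter ℕ).map fun n : ℕ => γ (n + t)).le_nhds_lim⟩
  choose ρ hρ using hex
  have hev (T : ℝ) : ∀ᶠ n : ℕ in hyperfilter ℕ, T ≤ n :=
    hU (tendsto_natCast_atTop_atTop.eventually_ge_atTop T)
  have hdist (s t : ℝ) : Tendsto (fun n : ℕ => dist (γ (n + s)) (γ (n + t))) (hyperfilter ℕ)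
      (nhds (dist (ρ s) (ρ t))) := (hρ s).dist (hρ t)
  have hρle {s t : ℝ} (hst : s ≤ t) : dist (ρ s) (ρ t) ≤ t - s := by
    refine le_of_tendsto (hdist s t) ?_
    filter_upwards [hev (-s)] with n hn
    linarith [hlip (n + s) (n + t) (by linarith) (by linarith)]
  have hρge {s t : ℝ} (hst : s ≤ t) (ht : t ≤ s + δ) : t - s ≤ dist (ρ s) (ρ t) := by
    refine le_of_forall_pos_sub_le fun ε hε => ?_
    obtain ⟨T, hT⟩ := hγ ε hε
    refine ge_of_tendsto (hdist s t) ?_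
    filter_upwards [hev (T - s)] with n hn
    linarith [hT (n + s) (n + t) (by linarith) (by linarith) (by linarith)]
  refine ⟨ρ, fun t => ⟨δ / 2, half_pos hδ, ?_⟩, fun a b _ => ?_⟩
  · rintro s ⟨hs, hs'⟩ u ⟨hu, hu'⟩
    rcases le_total s u with h | h
    · rw [abs_sub_comm, abs_of_nonneg (by linarith)]
      exact (hρle h).antisymm (hρge h (by linarith))
    · rw [dist_comm, abs_of_nonneg (by linarith)]
      exact (hρle h).antisymm (hρge h (by linarith))
  -- Pointwise convergence on a finite ε/3-net is uniform by the Lipschitz bounds; one shift per ε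
  -- then yields a genuine sequence.
  · have happrox (ε : ℝ) (hε : 0 < ε) : ∃ u : ℝ, 0 ≤ u ∧
        ∀ s ∈ Set.Icc a b, dist (ρ s) (γ (u + (s - a))) < ε := by
      obtain ⟨F, hF, hFfin, hcover⟩ := (isCompact_Icc (a := a) (b := b)).finite_cover_balls
        (show (0 : ℝ) < ε / 3 by positivity)
      have hpt : ∀ᶠ n : ℕ in hyperfilter ℕ, ∀ c ∈ F, dist (ρ c) (γ (n + c)) < ε / 3 := by
        refine (eventually_all_finite hFfin).2 fun c _ => ?_
        filter_upwards [(hρ c).eventually (Metric.ball_mem_nhds _ (show 0 < ε / 3 by positivity))]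
          with n hn
        rwa [dist_comm]
      obtain ⟨n, hn, hna⟩ := (hpt.and (hev (-a))).exists
      refine ⟨n + a, by linarith, fun s hs => ?_⟩
      obtain ⟨c, hc, hsc⟩ := Set.mem_iUnion₂.1 (hcover hs)
      have hca : a ≤ c := (hF hc).1
      have hsa : a ≤ s := hs.1
      rw [Metric.mem_ball, Real.dist_eq] at hsc
      have h1 : dist (ρ s) (ρ c) ≤ |s - c| := by
        rcases le_total s c with h | h
        · rw [abs_sub_comm]
          exact (hρle h).trans (le_abs_self _)
        · rw [dist_comm]
          exact (hρle h).trans (le_abs_self _)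
      have h2 : dist (γ (n + c)) (γ (n + s)) ≤ |s - c| := by
        rcases le_total s c with h | h
        · rw [abs_sub_comm, dist_comm]
          linarith [hlip (n + s) (n + c) (by linarith) (by linarith), le_abs_self (c - s)]
        · linarith [hlip (n + c) (n + s) (by linarith) (by linarith), le_abs_self (s - c)]
      have h3 : (n : ℝ) + a + (s - a) = n + s := by ring
      rw [h3]
      linarith [hn c hc, dist_triangle4 (ρ s) (ρ c) (γ (n + c)) (γ (n + s))]
    choose! u hu0 hu using happrox
    refine ⟨fun n => u (1 / ((n : ℝ) + 1)), fun n => hu0 _ (by positivity), ?_⟩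
    rw [Metric.tendstoUniformlyOn_iff]
    intro ε hε
    filter_upwards [tendsto_one_div_add_atTop_nhds_zero_nat.eventually (gt_mem_nhds hε)]
      with n hn s hs
    exact (hu _ (by positivity) s hs).trans hn

end Pursuit

theorem mainTheorem8 {X : Type*} [MetricSpace X] [CompactSpace X] (hX : Pursuit.IsCATOne X)
    (D : ℝ) (P E : ℕ → X) (hPE : Pursuit.IsSimplePursuit D P E)
    (hwin : Pursuit.EvaderWins D P E) (h0 : dist (P 0) (E 0) < Real.pi)
    (γ : ℝ → X) (hγ : Pursuit.IsPursuitCurve D P γ) :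
    ∃ ρ : ℝ → X, Pursuit.IsLocalGeodesicLine ρ ∧
      ∀ a b : ℝ, a ≤ b → Pursuit.IsLimitOfSegments γ ρ a b := by
  obtain ⟨δ, hδ, h⟩ := hPE.exists_asymptotically_geodesic hX hwin h0 hγ
  exact Pursuit.exists_limit_localGeodesicLine
    (fun _ _ hs hst => hγ.dist_le hPE.step_pos hs hst) hδ h
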